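/- Let $\mathbb F$ be a complete field with a nontrivial norm (absolute value) $|\cdot|$, let $d\ge 1$, and equip $\mathbb F^d$ with the maximum norm, whose open balls are denoted $B(u,\rho)$. *Spread sets.* Let $2^{\mathbb N}$ be the Cantor space with the metric $d(a,b)=2^{-n}$, where $n$ is the length of the longest common initial segment of $a\neq b$, and with the fair coin-tossing measure. A topological embedding $\iota:2^{\mathbb N}\to\mathbb F$ is *spread* if there are $C,\gamma>0$ with $|\iota(a)-\iota(b)|\ge C\,d(a,b)^\gamma$ for all $a,b$. A set $Y\subseteq\mathbb F^m$ ($m\ge 0$) is *affine-spread* if there are spread embeddings $\iota_1,\dots,\iota_m$ such that $(\iota_1\times\dots\times\iota_m)^{-1}(Y)$ has positive outer measure in $(2^{\mathbb N})^m$. A set $X\subseteq\mathbb F^d$ is *spread* if $\{(x_2/x_1,\dots,x_d/x_1): x\in X,\ x_1\ne 0\}\subseteq\mathbb F^{d-1}$ is affine-spread. *Functions.* A presheaf of functions $\mathcal F$ on $\mathbb F^d$ assigns to each open $U\subseteq\mathbb F^d$ a set $\mathcal F(U)$ of functions $U\to\mathbb F$ such that restrictions of members of $\mathcal F(U)$ to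 an open $V\subseteq U$ belong to $\mathcal F(V)$ (for example, any sheaf of functions). A formal power series $p=\sum_\alpha p_\alpha h^\alpha$ is the formal power series of $f$ at $u$ if $f(u+h)-\sum_{|\alpha|\le N}p_\alpha h^\alpha=o(\|h\|^N)$ as $h\to0$, for every $N$. A function $f:U\to\mathbb F$ is *smooth* if it has such a series at every $u\in U$, with coefficients that are continuous in $u$ and with remainders that are $o(\|h\|^N)$ locally uniformly in $u$. *Gentric presheaves.* A presheaf $\mathcal G$ of smooth functions is *gentric* if (a) whenever $f\in\mathcal G(B(u,\rho))$ and the formal power series of $f$ at the centre $u$ converges (unconditionally) at every point of $B(u,\rho)$, $f$ equals its sum on $B(u,\rho)$; and (b) there is a spread $X\subseteq\mathbb F^d$ such that for all open $U$, $f\in\mathcal G(U)$, $u\in U$ and $x\in X$ the function $z\mapsto f(u+zx)$ is analytic near $z=0$. *Noble presheaves.* A presheaf $\mathcal F$ of locally bounded functions is *noble* if 1. there is a spread $X\subseteq\mathbb F^d$ such that for all open $U$, $f\in\mathcal F(U)$, $u\in U$ and $x\in X$ the function $z\mapsto f(u+zx)$ is analytic near $z=0$; 2. for each open $U$ there is a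 function $r=r_U$ with values in $[0,\infty]$, defined on $\mathcal F(U)$ and on differences of its members, such that for $f_n,f\in\mathcal F(U)$ with $r(f_n-f)\to0$ we have $f_n\to f$ uniformly on $U$ and $r(f_n)\to r(f)$; moreover, if $U$ is bounded and $f$ is the restriction of a member of $\mathcal F(W)$ for some open $W\supseteq\overline U$, then $r(f)<\infty$; 3. there is a function $c(x,u,t,U)$ with values in $[0,\infty]$, monotone in $t\in[0,\infty]$ and finite for finite $t$, such that for all open $U$, $f\in\mathcal F(U)$, $u\in U$ and $x\in X$, writing $f(u+zx)=\sum_n a_n z^n$ for $z$ near $0$, we have $|a_n|\le c(x,u,r(f),U)^{n+1}$ for all $n\ge 0$; 4. there is a gentric presheaf $\mathcal G$ with $\mathcal G(U)\subseteq\mathcal F(U)$ for all $U$ such that, whenever $V$ is a bounded open set with $\overline V\subseteq U$, the restriction to $V$ of every member of $\mathcal F(U)$ lies in the closure of $\mathcal G(V)$ in $\mathcal F(V)$, for the topology in which $O\subseteq\mathcal F(V)$ is open if for each $f\in O$ there is $\varepsilon>0$ such that every $g\in\mathcal F(V)$ with $r(g-f)<\varepsilon$ lies in $O$. **Theorem.**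 Every function in a noble presheaf is analytic: if $\mathcal F$ is noble, $U\subseteq\mathbb F^d$ is open and $f\in\mathcal F(U)$, then at every point of $U$ the function $f$ is given, in a neighbourhood of the point, by a convergent power series over $\mathbb F$ in $d$ variables. In particular, every function in a noble sheaf is analytic. -/

import Mathlib

open Filter Topology MeasureTheory TopologicalSpace
open scoped ENNReal

noncomputable section

namespace Noble

/-! ### Spread sets -/

/-- The fair coin measure on one bit. -/
def bitMeasure : Measure Bool := (PMF.uniformOfFintype Bool).toMeasure

instance : IsProbabilityMeasure bitMeasure := by
  unfold bitMeasure; infer_instance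

/-- The natural measure on the Cantor space `ℕ → Bool`: the set of branches that extend a given
bitstring of length `n` has measure `2 ^ (-n)`. -/
def cantorMeasure : Measure (ℕ → Bool) := Measure.infinitePi fun _ => bitMeasure

instance : IsProbabilityMeasure cantorMeasure := by
  unfold cantorMeasure; infer_instance

/-- The metric on the Cantor space: `2 ^ (-n)`, where `n` is the depth to which two distinct
branches agree. -/
def cantorDist (x y : ℕ → Bool) : ℝ := (PiNat.dist (E := fun _ => Bool)).dist x y

/-- Spread embeddings of the Cantor space: `d (ι x, ι y) ≥ C * d (x, y) ^ γ` for some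
`C, γ > 0`. -/
def IsSpreadEmbedding {K : Type*} [NormedField K] (ι : (ℕ → Bool) → K) : Prop :=
  IsEmbedding ι ∧
    ∃ C γ : ℝ, 0 < C ∧ 0 < γ ∧ ∀ x y, C * cantorDist x y ^ γ ≤ dist (ι x) (ι y)

/-- Affine-spread subsets of `K ^ n`. A Mathlib measure is defined on all sets, as the outer
measure, so the last clause says that the preimage has positive outer measure. -/
def IsAffineSpread {K : Type*} [NormedField K] {n : ℕ} (X : Set (Fin n → K)) : Prop :=
  ∃ ι : Fin n → (ℕ → Bool) → K, (∀ i, IsSpreadEmbedding (ι i)) ∧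
    0 < Measure.pi (fun _ : Fin n => cantorMeasure) {t | (fun i => ι i (t i)) ∈ X}

/-- Spread sets of directions in `K ^ (d + 1)`: the set of all
`(x₁ / x₀, …, x_d / x₀)` with `x ∈ X`, `x₀ ≠ 0` is affine-spread. -/
def IsSpread {K : Type*} [NormedField K] {d : ℕ} (X : Set (Fin (d + 1) → K)) : Prop :=
  IsAffineSpread {y : Fin d → K | ∃ x ∈ X, x 0 ≠ 0 ∧ y = fun i => x i.succ / x 0}

/-! ### Functions on open sets -/

/-- The extension by zero of a function on an open set. Only its values on the open set matter
below. -/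
def ext {E K : Type*} [TopologicalSpace E] [Zero K] {U : Opens E} (f : U → K) : E → K :=
  Function.extend Subtype.val f 0

/-- The restriction of a function to a smaller open set. -/
def restr {E K : Type*} [TopologicalSpace E] {U V : Opens E} (h : V ≤ U) (f : U → K) : V → K :=
  fun x => f ⟨x.1, h x.2⟩

/-- A presheaf of `K`-valued functions on `E`: a class of functions on open sets that is closed
under restriction. Every sheaf of functions is one; that sections can be glued is not required. -/
structure FunctionPresheaf (E K : Type*) [TopologicalSpace E] where
  /-- The sections over an open set. -/
  sections : (U : Opens E) → Set (U → K)
  /-- Restrictions of sections are sections. -/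
  restr_mem : ∀ {U V : Opens E} (h : V ≤ U) {f : U → K},
    f ∈ sections U → restr h f ∈ sections V

/-! ### Smooth functions and formal power series -/

section Smooth

variable {K : Type*} [NontriviallyNormedField K] {n : ℕ}

/-- `p` is the formal power series (Taylor series) of `f` at `u`: for every `N`, its part of
degree at most `N` approximates `h ↦ f (u + h)` up to `o (‖h‖ ^ N)`. -/
def IsTaylorSeriesAt (f : (Fin n → K) → K) (u : Fin n → K) (p : MvPowerSeries (Fin n) K) : Prop :=
  ∀ N : ℕ, (fun h : Fin n → K => f (u + h) - MvPolynomial.eval h (p.truncTotal (N + 1)))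
    =o[𝓝 0] fun h => ‖h‖ ^ N

/-- Smooth functions over a valued field: there are Taylor coefficients that depend continuously
on the base point, and all Taylor remainders are `o (‖h‖ ^ N)` locally uniformly in the base
point. (For `K = ℝ` this is `C^∞`, by Taylor's theorem and its converse. In positive
characteristic it determines the coefficients, which iterated derivatives do not.) -/
def IsSmoothOn (f : (Fin n → K) → K) (U : Set (Fin n → K)) : Prop :=
  ∃ p : (Fin n → K) → MvPowerSeries (Fin n) K,
    (∀ α, ContinuousOn (fun u => MvPowerSeries.coeff α (p u)) U) ∧
    ∀ u ∈ U, ∀ N : ℕ,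
      (fun q : (Fin n → K) × (Fin n → K) =>
          f (q.1 + q.2) - MvPolynomial.eval q.2 ((p q.1).truncTotal (N + 1)))
        =o[𝓝 (u, 0)] fun q => ‖q.2‖ ^ N

/-- The terms of the formal power series `p`, centred at `u`, at the point `y`. -/
def seriesTerm (p : MvPowerSeries (Fin n) K) (u y : Fin n → K) (α : Fin n →₀ ℕ) : K :=
  MvPowerSeries.coeff α p * ∏ i, (y i - u i) ^ α i

/-- `f (u + z x) = ∑ a_m z ^ m` for all `z` near `0`. -/
def IsSliceExpansion (f : (Fin n → K) → K) (u x : Fin n → K) (a : ℕ → K) : Prop :=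
  ∀ᶠ z in 𝓝 (0 : K), HasSum (fun m => a m * z ^ m) (f (u + z • x))

end Smooth

/-! ### Gentric and noble presheaves -/

section Presheaves

variable {K : Type*} [NontriviallyNormedField K]

/-- For every section `f` over `U`, every `u ∈ U` and every direction `x ∈ X`, the function
`z ↦ f (u + z x)` of one variable is analytic near `z = 0`. -/
def IsSliceAnalytic {n : ℕ} (𝓕 : FunctionPresheaf (Fin n → K) K) (X : Set (Fin n → K)) : Prop :=
  ∀ U : Opens (Fin n → K), ∀ f ∈ 𝓕.sections U, ∀ u ∈ U, ∀ x ∈ X,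
    AnalyticAt K (fun z : K => ext f (u + z • x)) 0

/-- Pre-gentric presheaves: the sections are smooth, and a section over a ball `B (u, ρ)` whose
formal power series at the centre `u` converges on the ball is equal there to the sum of that
series. -/
def IsPreGentric {n : ℕ} (𝓖 : FunctionPresheaf (Fin n → K) K) : Prop :=
  (∀ U : Opens (Fin n → K), ∀ f ∈ 𝓖.sections U, IsSmoothOn (ext f) U) ∧
  ∀ (u : Fin n → K) (ρ : ℝ) (U : Opens (Fin n → K)), 0 < ρ → (U : Set _) = Metric.ball u ρ →
    ∀ f ∈ 𝓖.sections U, ∀ p : MvPowerSeries (Fin n) K, IsTaylorSeriesAt (ext f) u p →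
      (∀ y ∈ U, Summable (seriesTerm p u y)) →
      ∀ y ∈ U, HasSum (seriesTerm p u y) (ext f y)

/-- Gentric presheaves. -/
def IsGentric {d : ℕ} (𝓖 : FunctionPresheaf (Fin (d + 1) → K) K) : Prop :=
  IsPreGentric 𝓖 ∧ ∃ X : Set (Fin (d + 1) → K), IsSpread X ∧ IsSliceAnalytic 𝓖 X

/-- Every section is bounded near every point of its domain. -/
def IsLocallyBounded {n : ℕ} (𝓕 : FunctionPresheaf (Fin n → K) K) : Prop :=
  ∀ U : Opens (Fin n → K), ∀ f ∈ 𝓕.sections U, ∀ u ∈ U, ∃ M : ℝ, ∀ᶠ y in 𝓝 u, ‖ext f y‖ ≤ M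

/-- The controlling functional. It is defined on all functions, because differences of sections
need not be sections; it may be `∞` on functions that are not sections. -/
structure IsControl {n : ℕ} (𝓕 : FunctionPresheaf (Fin n → K) K)
    (r : (U : Opens (Fin n → K)) → (U → K) → ℝ≥0∞) : Prop where
  uniform : ∀ (U : Opens (Fin n → K)) (F : ℕ → U → K) (f : U → K),
    (∀ k, F k ∈ 𝓕.sections U) → f ∈ 𝓕.sections U →
    Tendsto (fun k => r U (F k - f)) atTop (𝓝 0) → TendstoUniformly F f atTop
  continuous : ∀ (U : Opens (Fin n → K)) (F : ℕ → U → K) (f : U → K),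
    (∀ k, F k ∈ 𝓕.sections U) → f ∈ 𝓕.sections U →
    Tendsto (fun k => r U (F k - f)) atTop (𝓝 0) →
    Tendsto (fun k => r U (F k)) atTop (𝓝 (r U f))
  finite : ∀ (U W : Opens (Fin n → K)) (hUW : U ≤ W), Bornology.IsBounded (U : Set (Fin n → K)) →
    closure (U : Set (Fin n → K)) ⊆ W → ∀ g ∈ 𝓕.sections W, r U (restr hUW g) ≠ ∞

/-- Uniform coefficient estimates: `c (x, u, t, U)` is monotone in `t` and finite for finite `t`,
and if `f (u + z x) = ∑ a_m z ^ m` then `|a_m| ≤ c (x, u, r f, U) ^ (m + 1)`. -/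
structure HasSliceEstimates {n : ℕ} (𝓕 : FunctionPresheaf (Fin n → K) K) (X : Set (Fin n → K))
    (r : (U : Opens (Fin n → K)) → (U → K) → ℝ≥0∞)
    (c : (Fin n → K) → (Fin n → K) → ℝ≥0∞ → Opens (Fin n → K) → ℝ≥0∞) : Prop where
  mono : ∀ U : Opens (Fin n → K), ∀ x ∈ X, ∀ u ∈ U, Monotone fun t => c x u t U
  finite : ∀ U : Opens (Fin n → K), ∀ x ∈ X, ∀ u ∈ U, ∀ t, t ≠ ∞ → c x u t U ≠ ∞
  bound : ∀ U : Opens (Fin n → K), ∀ f ∈ 𝓕.sections U, ∀ x ∈ X, ∀ u ∈ U, ∀ a : ℕ → K,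
    IsSliceExpansion (ext f) u x a → ∀ m, ‖a m‖ₑ ≤ c x u (r U f) U ^ (m + 1)

/-- The topology induced by `r` on the sections over `U`: a set is open if with each `f` it
contains all sections `g` with `r (g - f) < ε`, for some `ε > 0`. -/
abbrev controlTopology {n : ℕ} (𝓕 : FunctionPresheaf (Fin n → K) K)
    (r : (U : Opens (Fin n → K)) → (U → K) → ℝ≥0∞) (U : Opens (Fin n → K)) :
    TopologicalSpace (𝓕.sections U) where
  IsOpen O := ∀ f ∈ O, ∃ ε : ℝ≥0∞, 0 < ε ∧
    ∀ g : 𝓕.sections U, r U ((g : U → K) - (f : U → K)) < ε → g ∈ O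
  isOpen_univ := fun _ _ => ⟨1, one_pos, fun _ _ => trivial⟩
  isOpen_inter := fun s t hs ht f hf => by
    obtain ⟨ε, hε, h⟩ := hs f hf.1
    obtain ⟨δ, hδ, h'⟩ := ht f hf.2
    exact ⟨min ε δ, lt_min hε hδ, fun g hg =>
      ⟨h g (hg.trans_le (min_le_left _ _)), h' g (hg.trans_le (min_le_right _ _))⟩⟩
  isOpen_sUnion := fun S hS f ⟨s, hs, hf⟩ => by
    obtain ⟨ε, hε, h⟩ := hS s hs f hf
    exact ⟨ε, hε, fun g hg => ⟨s, hs, h g hg⟩⟩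

/-- `𝓖` is contained in `𝓕`, and if `V` is a bounded open set whose closure is contained in
`U`, then the restriction to `V` of every section of `𝓕` over `U` lies in the closure of the
sections of `𝓖` over `V`, in the topology induced by `r`. -/
def IsDenseSub {n : ℕ} (𝓖 𝓕 : FunctionPresheaf (Fin n → K) K)
    (r : (U : Opens (Fin n → K)) → (U → K) → ℝ≥0∞) : Prop :=
  (∀ U : Opens (Fin n → K), 𝓖.sections U ⊆ 𝓕.sections U) ∧
  ∀ (U V : Opens (Fin n → K)) (hVU : V ≤ U), Bornology.IsBounded (V : Set (Fin n → K)) →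
    closure (V : Set (Fin n → K)) ⊆ U → ∀ (f : U → K) (hf : f ∈ 𝓕.sections U),
      (⟨restr hVU f, 𝓕.restr_mem hVU hf⟩ : 𝓕.sections V) ∈
        @closure _ (controlTopology 𝓕 r V) {g | (g : V → K) ∈ 𝓖.sections V}

/-- Noble presheaves. -/
def IsNoble {d : ℕ} (𝓕 : FunctionPresheaf (Fin (d + 1) → K) K) : Prop :=
  IsLocallyBounded 𝓕 ∧
  ∃ X : Set (Fin (d + 1) → K), IsSpread X ∧ IsSliceAnalytic 𝓕 X ∧
  ∃ r : (U : Opens (Fin (d + 1) → K)) → (U → K) → ℝ≥0∞, IsControl 𝓕 r ∧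
  (∃ c, HasSliceEstimates 𝓕 X r c) ∧
  ∃ 𝓖 : FunctionPresheaf (Fin (d + 1) → K) K, IsGentric 𝓖 ∧ IsDenseSub 𝓖 𝓕 r

end Presheaves

end Noble

end

/-! A gentric section g near u is controlled by its restrictions to lines through u. In direction x
the m-th coefficient of z ↦ g (u + z x) is the value at x of the m-th homogeneous part of the Taylor
series (`coeff_eq_homEval`). Nobility bounds it by c ^ (m + 1), where c depends on x but not on g as
long as r g stays bounded.

A spread set of directions is large enough to recover the Taylor coefficients from these values at
the cost of a geometric factor (`exists_coeff_bound`). In one variable this is Lagrange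
interpolation: a set of positive outer measure contains m + 1 points such that the product of the
distances from any of them to the others is at least δ ^ (m + 1) (`exists_separated_points`,
`exists_dualWeights_one`). Fubini extends this to several variables (`exists_dualWeights`).

Hence the Taylor series of all such g converge on one common ball around u, and the gentric
condition makes each g equal to its sum there (`exists_series_of_gentric`). The bounds survive
limits (`exists_series_of_tendsto`), so f is such a sum too. As r need not satisfy a triangle
inequality, a point of the closure need not be the limit of a sequence; instead, a suitable set of
sections is shown to be closed (`isClosed_controlTopology`). -/

namespace Noble

/-! ### Cylinders of the Cantor space and separated points. -/

theorem bitMeasure_singleton (b : Bool) : bitMeasure {b} = 2⁻¹ := by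
  rw [bitMeasure, PMF.toMeasure_uniformOfFintype_apply _ (MeasurableSet.singleton b)]
  simp

theorem cantorMeasure_prefix (n : ℕ) (b : Fin n → Bool) :
    cantorMeasure {x | ∀ i : Fin n, x i = b i} = 2⁻¹ ^ n := by
  have h : {x : ℕ → Bool | ∀ i : Fin n, x i = b i} =
      ((Finset.range n : Finset ℕ) : Set ℕ).pi
        fun i => {if h : i < n then b ⟨i, h⟩ else false} := by
    ext x
    simp only [Set.mem_ofPred_eq, Set.mem_pi, Finset.coe_range, Set.mem_Iio, Set.mem_singleton_iff]
    exact ⟨fun hx i hi => by simpa [hi] using hx ⟨i, hi⟩, fun hx i => by simpa using hx i i.2⟩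
  rw [h, cantorMeasure, Measure.infinitePi_pi _ fun i _ => MeasurableSet.singleton _]
  simp [bitMeasure_singleton]

/-- A set of positive outer measure meets a positive proportion of the cylinders of depth `n`. -/
theorem cantorMeasure_le_card (E : Set (ℕ → Bool)) (n : ℕ) :
    cantorMeasure E * 2 ^ n ≤
      (Nat.card ((fun (x : ℕ → Bool) (i : Fin n) => x i) '' E) : ℝ≥0∞) := by
  classical
  set S : Finset (Fin n → Bool) := ((fun (x : ℕ → Bool) (i : Fin n) => x i) '' E).toFinset
  have hS : Nat.card ((fun (x : ℕ → Bool) (i : Fin n) => x i) '' E) = S.card := by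
    rw [Nat.card_eq_fintype_card, Set.toFinset_card]
  have hE : E ⊆ ⋃ b ∈ S, {x : ℕ → Bool | ∀ i : Fin n, x i = b i} := by
    intro x hx
    simp only [Set.mem_iUnion]
    exact ⟨fun i => x i, by simpa [S] using ⟨x, hx, rfl⟩, fun i => rfl⟩
  have h1 : cantorMeasure E ≤ S.card * 2⁻¹ ^ n := by
    refine (measure_mono hE).trans ((measure_biUnion_finset_le _ _).trans ?_)
    simp [cantorMeasure_prefix]
  rw [hS]
  calc cantorMeasure E * 2 ^ n ≤ S.card * 2⁻¹ ^ n * 2 ^ n := by gcongr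
    _ = S.card := by
      rw [mul_assoc, ← mul_pow, ENNReal.inv_mul_cancel (by simp) (by simp), one_pow, mul_one]

/-- Points with distinct prefixes of length `n`: the sum of the agreement depths with one of
them is at most `2 ^ n`. -/
theorem sum_firstDiff_le {J : Type*} [Fintype J] [DecidableEq J] (n : ℕ) (t : J → ℕ → Bool)
    (ht : Function.Injective fun j (i : Fin n) => t j i) (j : J) :
    ∑ k ∈ Finset.univ.erase j, PiNat.firstDiff (E := fun _ => Bool) (t j) (t k) ≤ 2 ^ n := by
  have hne : ∀ k ∈ Finset.univ.erase j, t j ≠ t k := fun k hk h =>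
    (Finset.ne_of_mem_erase hk) (ht (by simp [h]))
  have hlt : ∀ k ∈ Finset.univ.erase j,
      PiNat.firstDiff (E := fun _ => Bool) (t j) (t k) < n := by
    intro k hk
    by_contra! h
    refine (Finset.ne_of_mem_erase hk) (ht ?_)
    funext i
    exact (PiNat.apply_eq_of_lt_firstDiff (i.2.trans_le h)).symm
  -- A chosen point that agrees with `t j` in the first i + 1 bits is determined by its bits i + 1,
  -- …, n - 1.
  have hcard : ∀ i ∈ Finset.range n, ((Finset.univ.erase j).filter fun k =>
      i < PiNat.firstDiff (E := fun _ => Bool) (t j) (t k)).card ≤ 2 ^ (n - 1 - i) := by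
    intro i hi
    have hi := Finset.mem_range.1 hi
    have : ((Finset.univ.erase j).filter fun k =>
        i < PiNat.firstDiff (E := fun _ => Bool) (t j) (t k)).card ≤
        (Finset.univ : Finset (Fin (n - 1 - i) → Bool)).card := by
      refine Finset.card_le_card_of_injOn (fun k l => t k (i + 1 + l)) (by simp) ?_
      intro k hk k' hk' h
      simp only [Finset.coe_filter, Set.mem_ofPred_eq] at hk hk'
      refine ht ?_
      funext l
      by_cases hl : (l : ℕ) < i + 1
      · exact (PiNat.apply_eq_of_lt_firstDiff (hl.trans_le hk.2)).symm.trans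
          (PiNat.apply_eq_of_lt_firstDiff (hl.trans_le hk'.2))
      · have := congrFun h ⟨l - (i + 1), by omega⟩
        simpa [show i + 1 + ((l : ℕ) - (i + 1)) = l by omega] using this
    simpa using this
  -- Each depth is the number of levels below it, so the sum can be taken level by level and is
  -- dominated by a geometric series.
  calc ∑ k ∈ Finset.univ.erase j, PiNat.firstDiff (E := fun _ => Bool) (t j) (t k)
      = ∑ k ∈ Finset.univ.erase j, ∑ i ∈ Finset.range n,
          if i < PiNat.firstDiff (E := fun _ => Bool) (t j) (t k) then 1 else 0 := by
        refine Finset.sum_congr rfl fun k hk => ?_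
        rw [← Finset.sum_filter, Finset.sum_const, smul_eq_mul, mul_one]
        have : (Finset.range n).filter
            (fun i => i < PiNat.firstDiff (E := fun _ => Bool) (t j) (t k)) =
            Finset.range (PiNat.firstDiff (E := fun _ => Bool) (t j) (t k)) := by
          ext i
          have := hlt k hk
          simp only [Finset.mem_filter, Finset.mem_range]
          omega
        rw [this, Finset.card_range]
    _ = ∑ i ∈ Finset.range n, ((Finset.univ.erase j).filter fun k =>
          i < PiNat.firstDiff (E := fun _ => Bool) (t j) (t k)).card := by
        rw [Finset.sum_comm]
        exact Finset.sum_congr rfl fun i _ => (Finset.card_filter _ _).symm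
    _ ≤ ∑ i ∈ Finset.range n, 2 ^ (n - 1 - i) := Finset.sum_le_sum hcard
    _ ≤ 2 ^ n := by
        rw [Finset.sum_range_reflect (fun i => 2 ^ i) n]
        have := Nat.geomSum_eq (le_refl 2) n
        rw [this]
        simp

/-- A set of positive outer measure contains, for each `m`, `m + 1` points that are separated
from each other on average, at a scale that does not depend on `m`. -/
theorem exists_separated_points (E : Set (ℕ → Bool)) (hE : 0 < cantorMeasure E) :
    ∃ B : ℕ, ∀ m : ℕ, ∃ t : Fin (m + 1) → ℕ → Bool, Function.Injective t ∧ (∀ j, t j ∈ E) ∧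
      ∀ j, ∑ k ∈ Finset.univ.erase j, PiNat.firstDiff (E := fun _ => Bool) (t j) (t k) ≤
        B * (m + 1) := by
  obtain ⟨k, hk⟩ : ∃ k : ℕ, 1 ≤ cantorMeasure E * 2 ^ k := by
    have h := ENNReal.tendsto_pow_atTop_nhds_top_iff.2 (show (1 : ℝ≥0∞) < 2 by norm_num)
    have h2 := ENNReal.Tendsto.const_mul (a := cantorMeasure E) h (Or.inl (by simp))
    rw [ENNReal.mul_top hE.ne'] at h2
    obtain ⟨k, hk⟩ := (h2.eventually (lt_mem_nhds (show (1 : ℝ≥0∞) < ⊤ by simp))).exists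
    exact ⟨k, hk.le⟩
  -- The factor 2 ^ k pays for the measure of `E`, the factor 2 for rounding m + 1 up to a power of
  -- two.
  refine ⟨2 ^ k * 2, fun m => ?_⟩
  set l := Nat.clog 2 (m + 1)
  have hl : m + 1 ≤ 2 ^ l := Nat.le_pow_clog one_lt_two _
  have hl2 : 2 ^ l ≤ 2 * (m + 1) := by
    rcases Nat.eq_zero_or_pos m with rfl | hm
    · simp [l]
    · have := Nat.pow_pred_clog_lt_self one_lt_two (show 1 < m + 1 by omega)
      have h1 : 0 < l := Nat.clog_pos one_lt_two (by omega)
      have h2 : 2 ^ l = 2 * 2 ^ l.pred := by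
        rw [← pow_succ', ← Nat.succ_eq_add_one, Nat.succ_pred_eq_of_pos h1]
      have h3 : 2 ^ l.pred < m + 1 := this
      omega
  have hcard : m + 1 ≤ Nat.card ((fun (x : ℕ → Bool) (i : Fin (k + l)) => x i) '' E) := by
    have h := cantorMeasure_le_card E (k + l)
    have h3 : ((m + 1 : ℕ) : ℝ≥0∞) ≤ cantorMeasure E * 2 ^ (k + l) := by
      calc ((m + 1 : ℕ) : ℝ≥0∞) ≤ ((2 ^ l : ℕ) : ℝ≥0∞) := by exact_mod_cast hl
        _ = 1 * 2 ^ l := by simp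
        _ ≤ (cantorMeasure E * 2 ^ k) * 2 ^ l := by gcongr
        _ = _ := by rw [pow_add, mul_assoc]
    exact_mod_cast h3.trans h
  obtain ⟨e⟩ : Nonempty (Fin (m + 1) ↪
      ((fun (x : ℕ → Bool) (i : Fin (k + l)) => x i) '' E)) := by
    classical
    refine Function.Embedding.nonempty_of_card_le ?_
    rw [← Nat.card_eq_fintype_card, ← Nat.card_eq_fintype_card]
    simpa using hcard
  choose t ht ht2 using fun j => (e j).2
  have hinj : Function.Injective fun j (i : Fin (k + l)) => t j i := by
    intro j j' h
    refine e.injective (Subtype.ext ?_)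
    rw [← ht2 j, ← ht2 j']
    exact h
  refine ⟨t, fun j j' h => hinj (by simp [h]), ht, fun j => ?_⟩
  refine (sum_firstDiff_le (k + l) t hinj j).trans ?_
  rw [pow_add, mul_assoc]
  exact Nat.mul_le_mul_left _ hl2

/-! ### Interpolation functionals with geometrically bounded norms. -/

/-- Each factor is (x - v k)⁻¹ (X - v k), and multiplication by X - v k enlarges the largest
coefficient at most 1 + R times. -/
theorem norm_coeff_prod_basisDivisor_le {K J : Type*} [NormedField K] (s : Finset J) (x : K)
    (v : J → K) {R : ℝ} (hR : ∀ j, ‖v j‖ ≤ R) (n : ℕ) :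
    ‖(∏ k ∈ s, Lagrange.basisDivisor x (v k)).coeff n‖ ≤ ∏ k ∈ s, (‖x - v k‖⁻¹ * (1 + R)) := by
  classical
  induction s using Finset.induction_on generalizing n with
  | empty =>
    rw [Finset.prod_empty, Finset.prod_empty, Polynomial.coeff_one]
    split_ifs <;> simp
  | insert a s ha ih =>
    rw [Finset.prod_insert ha, Finset.prod_insert ha]
    set Q := ∏ k ∈ s, Lagrange.basisDivisor x (v k)
    set q := ∏ k ∈ s, (‖x - v k‖⁻¹ * (1 + R))
    have hq : 0 ≤ q := (norm_nonneg _).trans (ih 0)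
    have hX : ‖(Polynomial.X * Q).coeff n‖ ≤ q := by
      cases n with
      | zero => simpa using hq
      | succ n => rw [Polynomial.coeff_X_mul]; exact ih n
    have hC : ‖(Polynomial.C (v a) * Q).coeff n‖ ≤ R * q := by
      rw [Polynomial.coeff_C_mul, norm_mul]
      exact mul_le_mul (hR a) (ih n) (norm_nonneg _) ((norm_nonneg _).trans (hR a))
    rw [Lagrange.basisDivisor, mul_assoc, Polynomial.coeff_C_mul, sub_mul, Polynomial.coeff_sub,
      norm_mul, norm_inv, mul_assoc]
    refine mul_le_mul_of_nonneg_left ((norm_sub_le _ _).trans ?_) (by positivity)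
    linarith

/-- On a set of positive outer measure, the coefficients of polynomials of degree at most `m` are
values of functionals that are supported on the set and have norm at most `M ^ (m + 1)`. -/
theorem exists_dualWeights_one {K : Type*} [NormedField K] {ι : (ℕ → Bool) → K}
    (hι : IsSpreadEmbedding ι) (E : Set (ℕ → Bool)) (hE : 0 < cantorMeasure E) :
    ∃ M : ℝ, 1 ≤ M ∧ ∀ m α : ℕ, α ≤ m → ∃ (t : Fin (m + 1) → ℕ → Bool) (w : Fin (m + 1) → K),
      (∀ j, t j ∈ E) ∧ ∑ j, ‖w j‖ ≤ M ^ (m + 1) ∧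
      ∀ β ≤ m, ∑ j, w j * ι (t j) ^ β = if β = α then 1 else 0 := by
  obtain ⟨hemb, C, γ, hC, hγ, hspread⟩ := hι
  obtain ⟨B, hB⟩ := exists_separated_points E hE
  obtain ⟨R, hR⟩ : ∃ R : ℝ, ∀ x, ‖ι x‖ ≤ R := by
    obtain ⟨R, hR⟩ := (isCompact_range hemb.continuous).isBounded.exists_norm_le
    exact ⟨R, fun x => hR _ ⟨x, rfl⟩⟩
  have hR0 : 0 ≤ R := (norm_nonneg _).trans (hR fun _ => false)
  set A : ℝ := 2 ^ γ
  have hA : 1 ≤ A := Real.one_le_rpow one_le_two hγ.le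
  set D : ℝ := max 1 (C⁻¹ * (1 + R))
  have hD : 1 ≤ D := le_max_left _ _
  -- `D` is the cost of one node and `A ^ B` the averaged cost of separation; the 2 absorbs the
  -- number m + 1 of nodes.
  refine ⟨2 * (D * A ^ B), ?_, fun m α hα => ?_⟩
  · have : 1 ≤ D * A ^ B := one_le_mul_of_one_le_of_one_le hD (one_le_pow₀ hA)
    linarith
  obtain ⟨t, htinj, htE, hsum⟩ := hB m
  have hv : Function.Injective fun j => ι (t j) := hemb.injective.comp htinj
  -- Interpolation at m + 1 nodes reproduces X ^ β for β ≤ m, so comparing coefficients of X ^ α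
  -- gives duality.
  refine ⟨t, fun j => (Lagrange.basis Finset.univ (fun j => ι (t j)) j).coeff α, htE, ?_, ?_⟩
  · have key : ∀ j, ‖(Lagrange.basis Finset.univ (fun j => ι (t j)) j).coeff α‖ ≤
        (D * A ^ B) ^ (m + 1) := by
      intro j
      refine (norm_coeff_prod_basisDivisor_le _ _ _ (fun j => hR (t j)) α).trans ?_
      have h1 : ∀ k ∈ Finset.univ.erase j, ‖ι (t j) - ι (t k)‖⁻¹ * (1 + R) ≤
          D * A ^ PiNat.firstDiff (E := fun _ => Bool) (t j) (t k) := by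
        intro k hk
        have hne : t j ≠ t k := fun h => (Finset.ne_of_mem_erase hk) (htinj h).symm
        have h := hspread (t j) (t k)
        rw [cantorDist, PiNat.dist_eq_of_ne hne, dist_eq_norm] at h
        set q := PiNat.firstDiff (E := fun _ => Bool) (t j) (t k)
        have h2 : ((1 / 2 : ℝ) ^ q) ^ γ = (A ^ q)⁻¹ := by
          rw [← Real.rpow_natCast, ← Real.rpow_mul (by norm_num), mul_comm, Real.rpow_mul
            (by norm_num), Real.rpow_natCast, one_div, Real.inv_rpow (by norm_num), inv_pow]
        rw [h2] at h
        have hAq : 0 < A ^ q := by positivity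
        have h3 : ‖ι (t j) - ι (t k)‖⁻¹ ≤ C⁻¹ * A ^ q := by
          rw [← inv_inv (A ^ q), ← mul_inv]
          exact inv_anti₀ (by positivity) h
        calc ‖ι (t j) - ι (t k)‖⁻¹ * (1 + R) ≤ (C⁻¹ * A ^ q) * (1 + R) := by gcongr
          _ = (C⁻¹ * (1 + R)) * A ^ q := by ring
          _ ≤ D * A ^ q := by gcongr; exact le_max_right _ _
      refine (Finset.prod_le_prod (fun k _ => by positivity) h1).trans ?_
      rw [Finset.prod_mul_distrib, Finset.prod_const, Finset.prod_pow_eq_pow_sum,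
        Finset.card_erase_of_mem (Finset.mem_univ _), Finset.card_univ, Fintype.card_fin, mul_pow,
        ← pow_mul]
      have := hsum j
      gcongr
      omega
    calc ∑ j, ‖(Lagrange.basis Finset.univ (fun j => ι (t j)) j).coeff α‖
        ≤ ∑ _j : Fin (m + 1), (D * A ^ B) ^ (m + 1) := Finset.sum_le_sum fun j _ => key j
      _ = (m + 1 : ℝ) * (D * A ^ B) ^ (m + 1) := by simp
      _ ≤ 2 ^ (m + 1) * (D * A ^ B) ^ (m + 1) := by
        gcongr
        exact_mod_cast (Nat.lt_two_pow_self (n := m + 1)).le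
      _ = _ := (mul_pow _ _ _).symm
  · intro β hβ
    have h := Lagrange.eq_interpolate (f := (Polynomial.X ^ β : Polynomial K))
      (s := Finset.univ) (v := fun j => ι (t j)) hv.injOn (by
        rw [Polynomial.degree_X_pow, Finset.card_univ, Fintype.card_fin]
        exact_mod_cast Nat.lt_succ_of_le hβ)
    have h2 := congrArg (fun P => Polynomial.coeff P α) h
    simp only [Lagrange.interpolate_apply, Polynomial.finsetSum_coeff, Polynomial.coeff_C_mul,
      Polynomial.eval_pow, Polynomial.eval_X, Polynomial.coeff_X_pow] at h2
    simp_rw [mul_comm _ (ι _ ^ β), ← h2, eq_comm]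

/-- The functionals of `exists_dualWeights_one` in several variables. -/
theorem exists_dualWeights {K : Type*} [NormedField K] {d : ℕ} {ι : Fin d → (ℕ → Bool) → K}
    (hι : ∀ i, IsSpreadEmbedding (ι i)) (E : Set (Fin d → ℕ → Bool)) (hE : MeasurableSet E)
    (hpos : 0 < Measure.pi (fun _ : Fin d => cantorMeasure) E) :
    ∃ M : ℝ, 1 ≤ M ∧ ∀ (m : ℕ) (α : Fin d → ℕ), (∀ i, α i ≤ m) →
      ∃ (J : Type) (_ : Fintype J) (t : J → Fin d → ℕ → Bool) (w : J → K),
        (∀ j, t j ∈ E) ∧ ∑ j, ‖w j‖ ≤ M ^ (m + 1) ∧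
        ∀ β : Fin d → ℕ, (∀ i, β i ≤ m) →
          ∑ j, w j * ∏ i, ι i (t j i) ^ β i = if β = α then 1 else 0 := by
  induction d with
  | zero =>
    refine ⟨1, le_rfl, fun m α _ => ?_⟩
    obtain ⟨e, he⟩ := nonempty_of_measure_ne_zero hpos.ne'
    exact ⟨Unit, inferInstance, fun _ => e, fun _ => 1, fun _ => he, by simp,
      fun β _ => by simp [Subsingleton.elim β α]⟩
  | succ d ih =>
    set S : (ℕ → Bool) → Set (Fin d → ℕ → Bool) := fun x => {y | Fin.cons x y ∈ E}
    have hcons : Measurable fun p : (ℕ → Bool) × (Fin d → ℕ → Bool) =>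
        (Fin.cons p.1 p.2 : Fin (d + 1) → ℕ → Bool) := by
      refine measurable_pi_iff.2 fun i => ?_
      refine Fin.cases ?_ (fun i => ?_) i
      · simpa using measurable_fst
      · simp only [Fin.cons_succ]
        exact (measurable_pi_apply i).comp measurable_snd
    have hSm : ∀ x, MeasurableSet (S x) := fun x =>
      (hcons.comp measurable_prodMk_left) hE
    choose! M hM1 hM using fun x (hx : 0 < Measure.pi (fun _ : Fin d => cantorMeasure) (S x)) =>
      ih (fun i => hι i.succ) (S x) (hSm x) hx
    -- Otherwise almost every slice is null, and so is `E` by Fubini. The set of good x may be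
    -- non-measurable, which the one-variable result allows.
    obtain ⟨N, hN⟩ : ∃ N : ℕ, 0 < cantorMeasure
        {x | 0 < Measure.pi (fun _ : Fin d => cantorMeasure) (S x) ∧ M x ≤ N} := by
      refine exists_measure_pos_of_not_measure_iUnion_null fun h0 => hpos.ne' ?_
      have hmp := (measurePreserving_piFinSuccAbove
        (fun _ : Fin (d + 1) => cantorMeasure) 0).symm
      have h1 := hmp.measure_preimage hE.nullMeasurableSet
      rw [← h1]
      refine Measure.measure_prod_null_of_ae_null (hmp.measurable hE) ?_
      have h2 : (⋃ N : ℕ, {x | 0 < Measure.pi (fun _ : Fin d => cantorMeasure) (S x) ∧ M x ≤ N}) =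
          {x | 0 < Measure.pi (fun _ : Fin d => cantorMeasure) (S x)} := by
        ext x
        simp only [Set.mem_iUnion, Set.mem_ofPred_eq]
        exact ⟨fun ⟨N, h, _⟩ => h, fun h => ⟨_, h, (exists_nat_ge (M x)).choose_spec⟩⟩
      rw [h2] at h0
      filter_upwards [compl_mem_ae_iff.2 h0] with x hx
      have : Measure.pi (fun _ : Fin d => cantorMeasure) (S x) = 0 := by simpa using hx
      refine Eq.trans (congrArg _ ?_) this
      ext y
      simp [S, MeasurableEquiv.piFinSuccAbove, Fin.insertNthEquiv]
    obtain ⟨M₁, hM₁, hw⟩ := exists_dualWeights_one (hι 0) _ hN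
    have hN1 : (1 : ℝ) ≤ N := by
      obtain ⟨x, hx⟩ := nonempty_of_measure_ne_zero hN.ne'
      exact (hM1 x hx.1).trans hx.2
    refine ⟨M₁ * N, one_le_mul_of_one_le_of_one_le hM₁ hN1, fun m α hα => ?_⟩
    obtain ⟨t, w, ht, hwn, hwd⟩ := hw m (α 0) (hα 0)
    choose J hJ t' w' ht' hwn' hwd' using fun j =>
      hM (t j) (ht j).1 m (fun i => α i.succ) fun i => hα i.succ
    -- The nodes above `t j` lie in its own slice and vary with `j`. The bound `N` is common to all
    -- these slices, so the norms multiply.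
    refine ⟨Σ j, J j, inferInstance, fun p => Fin.cons (t p.1) (t' p.1 p.2),
      fun p => w p.1 * w' p.1 p.2, fun p => ht' p.1 p.2, ?_, fun β hβ => ?_⟩
    · simp only [Fintype.sum_sigma, norm_mul, ← Finset.mul_sum]
      calc ∑ j, ‖w j‖ * ∑ k, ‖w' j k‖ ≤ ∑ j, ‖w j‖ * N ^ (m + 1) := by
            refine Finset.sum_le_sum fun j _ => mul_le_mul_of_nonneg_left ?_ (norm_nonneg _)
            refine (hwn' j).trans (pow_le_pow_left₀ ?_ (ht j).2 _)
            exact zero_le_one.trans (hM1 _ (ht j).1)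
        _ ≤ M₁ ^ (m + 1) * N ^ (m + 1) := by
            rw [← Finset.sum_mul]
            gcongr
        _ = _ := (mul_pow _ _ _).symm
    · simp only [Fintype.sum_sigma, Fin.prod_univ_succ, Fin.cons_zero, Fin.cons_succ]
      have h1 : ∀ j, ∑ k, w j * w' j k * (ι 0 (t j) ^ β 0 * ∏ i, ι (Fin.succ i) (t' j k i) ^
          β i.succ) = w j * ι 0 (t j) ^ β 0 *
            if (fun i : Fin d => β i.succ) = (fun i => α i.succ) then 1 else 0 := by
        intro j
        rw [← hwd' j (fun i => β i.succ) fun i => hβ i.succ, Finset.mul_sum]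
        exact Finset.sum_congr rfl fun k _ => by ring
      simp_rw [h1, ← Finset.sum_mul]
      rw [hwd (β 0) (hβ 0)]
      have h2 : β = α ↔ β 0 = α 0 ∧ (fun i : Fin d => β i.succ) = (fun i => α i.succ) := by
        rw [funext_iff, Fin.forall_fin_succ, funext_iff]
      by_cases ha : β 0 = α 0 <;>
        by_cases hb : (fun i : Fin d => β i.succ) = (fun i => α i.succ) <;> simp [h2, ha, hb]

/-! ### Homogeneous parts of power series. -/

/-- The value at `x` of the homogeneous part of degree `m` of a power series. -/
def homEval {K : Type*} [CommRing K] {n : ℕ} (p : MvPowerSeries (Fin n) K) (m : ℕ)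
    (x : Fin n → K) : K :=
  ∑ α ∈ Finset.finsuppAntidiag Finset.univ m, MvPowerSeries.coeff α p * ∏ i, x i ^ α i

theorem mem_finsuppAntidiag_univ {n m : ℕ} {α : Fin n →₀ ℕ} :
    α ∈ Finset.finsuppAntidiag Finset.univ m ↔ α.degree = m := by
  simp [Finsupp.degree_eq_sum]

section Algebra

variable {K : Type*} [CommRing K] {n : ℕ}

theorem prod_smul_pow (z : K) (x : Fin n → K) (α : Fin n →₀ ℕ) :
    ∏ i, (z • x) i ^ α i = z ^ α.degree * ∏ i, x i ^ α i := by
  simp [mul_pow, Finset.prod_mul_distrib, Finset.prod_pow_eq_pow_sum, Finsupp.degree_eq_sum]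

theorem homEval_smul (p : MvPowerSeries (Fin n) K) (m : ℕ) (z : K) (x : Fin n → K) :
    homEval p m (z • x) = z ^ m * homEval p m x := by
  rw [homEval, homEval, Finset.mul_sum]
  refine Finset.sum_congr rfl fun α hα => ?_
  rw [prod_smul_pow, mem_finsuppAntidiag_univ.1 hα]
  ring

theorem sum_biUnion_finsuppAntidiag (p : MvPowerSeries (Fin n) K) (N : ℕ) (x : Fin n → K) :
    ∑ α ∈ (Finset.range N).biUnion (Finset.finsuppAntidiag Finset.univ),
      MvPowerSeries.coeff α p * ∏ i, x i ^ α i = ∑ m ∈ Finset.range N, homEval p m x := by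
  rw [Finset.sum_biUnion]
  · rfl
  · intro a _ b _ hab
    rw [Function.onFun, Finset.disjoint_left]
    intro α ha hb
    exact hab ((mem_finsuppAntidiag_univ.1 ha).symm.trans (mem_finsuppAntidiag_univ.1 hb))

theorem mem_biUnion_finsuppAntidiag {N : ℕ} {α : Fin n →₀ ℕ} :
    α ∈ (Finset.range N).biUnion (Finset.finsuppAntidiag Finset.univ) ↔ α.degree < N := by
  simp [Finsupp.degree_eq_sum]

theorem eval_truncTotal (p : MvPowerSeries (Fin n) K) (N : ℕ) (x : Fin n → K) :
    MvPolynomial.eval x (p.truncTotal N) = ∑ m ∈ Finset.range N, homEval p m x := by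
  rw [← sum_biUnion_finsuppAntidiag, MvPolynomial.eval_eq']
  rw [Finset.sum_subset
    (s₂ := (Finset.range N).biUnion (Finset.finsuppAntidiag Finset.univ))]
  · refine Finset.sum_congr rfl fun α hα => ?_
    rw [MvPowerSeries.coeff_truncTotal _ (mem_biUnion_finsuppAntidiag.1 hα)]
  · intro α hα
    rw [mem_biUnion_finsuppAntidiag]
    by_contra! h
    exact MvPolynomial.mem_support_iff.1 hα (MvPowerSeries.coeff_truncTotal_eq_zero _ h)
  · intro α _ hα
    rw [MvPolynomial.notMem_support_iff.1 hα, zero_mul]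

/-- Functionals that are dual to the monomials in `d` variables recover the coefficients of a
power series in `d + 1` variables from the values of its homogeneous parts. -/
theorem sum_weights_mul_homEval {d : ℕ} {α : Fin (d + 1) →₀ ℕ} {J : Type*} [Fintype J]
    (y : J → Fin d → K) (w : J → K)
    (h : ∀ β : Fin d → ℕ, (∀ i, β i ≤ α.degree) →
      ∑ j, w j * ∏ i, y j i ^ β i = if β = (fun i => α i.succ) then 1 else 0)
    (p : MvPowerSeries (Fin (d + 1)) K) :
    ∑ j, w j * homEval p α.degree (Fin.cons 1 (y j)) = MvPowerSeries.coeff α p := by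
  simp_rw [homEval, Finset.mul_sum]
  rw [Finset.sum_comm]
  have key : ∀ β ∈ Finset.finsuppAntidiag (Finset.univ : Finset (Fin (d + 1))) α.degree,
      ∑ j, w j * (MvPowerSeries.coeff β p * ∏ i, (Fin.cons 1 (y j) : Fin (d + 1) → K) i ^ β i) =
        if β = α then MvPowerSeries.coeff α p else 0 := by
    intro β hβ
    rw [mem_finsuppAntidiag_univ] at hβ
    have hle : ∀ i : Fin d, β i.succ ≤ α.degree := fun i => by
      rw [← hβ]
      exact Finsupp.le_degree _ _
    have h1 := h (fun i => β i.succ) hle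
    -- Among multi-indices of equal degree, the last d exponents determine the first.
    have h2 : (fun i : Fin d => β i.succ) = (fun i => α i.succ) ↔ β = α := by
      refine ⟨fun hs => ?_, fun hs => by rw [hs]⟩
      have hs' : ∀ i : Fin d, β i.succ = α i.succ := congrFun hs
      have h0 : β 0 = α 0 := by
        simpa [Finsupp.degree_eq_sum, Fin.sum_univ_succ, hs'] using hβ
      ext i
      exact Fin.cases h0 hs' i
    simp only [Fin.prod_univ_succ, Fin.cons_zero, one_pow, one_mul, Fin.cons_succ]
    simp_rw [mul_left_comm (w _), ← Finset.mul_sum]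
    rw [h1]
    by_cases hb : β = α
    · rw [if_pos (h2.2 hb), if_pos hb, mul_one, hb]
    · rw [if_neg (fun hh => hb (h2.1 hh)), if_neg hb, mul_zero]
  rw [Finset.sum_congr rfl key, Finset.sum_ite_eq', if_pos (mem_finsuppAntidiag_univ.2 rfl)]

end Algebra

/-! ### Coefficients recovered from a spread set of directions. -/

theorem continuous_homEval {K : Type*} [NormedField K] {n : ℕ} (p : MvPowerSeries (Fin n) K)
    (m : ℕ) : Continuous (homEval p m) := by
  unfold homEval
  fun_prop

/-- If the homogeneous parts of a power series grow at most geometrically in every direction of a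
spread set, then so do its coefficients, with a bound that does not depend on the series. -/
theorem exists_coeff_bound {K : Type*} [NormedField K] {d : ℕ} {X : Set (Fin (d + 1) → K)}
    (hX : IsSpread X) (c : (Fin (d + 1) → K) → ℝ≥0∞) (hc : ∀ x ∈ X, c x ≠ ∞) :
    ∃ M : ℝ, 1 ≤ M ∧ ∀ p : MvPowerSeries (Fin (d + 1)) K,
      (∀ x ∈ X, ∀ m, ‖homEval p m x‖ₑ ≤ c x ^ (m + 1)) →
      ∀ α, ‖MvPowerSeries.coeff α p‖ ≤ M ^ (α.degree + 1) := by
  obtain ⟨ι, hι, hpos⟩ := hX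
  -- Countably many levels make `c` uniform; the last condition absorbs the cost of scaling x to
  -- first coordinate 1.
  set E : ℕ → Set (Fin d → ℕ → Bool) := fun N => {t | ∃ x ∈ X, x 0 ≠ 0 ∧
    (fun i => ι i (t i)) = (fun i : Fin d => x i.succ / x 0) ∧
    (c x).toReal ≤ N ∧ (c x).toReal / ‖x 0‖ ≤ N}
  obtain ⟨N, hN⟩ : ∃ N, 0 < Measure.pi (fun _ : Fin d => cantorMeasure) (E N) := by
    refine exists_measure_pos_of_not_measure_iUnion_null fun h0 => hpos.ne' ?_
    refine measure_mono_null ?_ h0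
    rintro t ⟨x, hx, hx0, hxt⟩
    obtain ⟨N, hN⟩ := exists_nat_ge (max (c x).toReal ((c x).toReal / ‖x 0‖))
    exact Set.mem_iUnion.2 ⟨N, x, hx, hx0, hxt, (le_max_left _ _).trans hN,
      (le_max_right _ _).trans hN⟩
  -- `E N` may be non-measurable, but the estimate for each homogeneous part is a closed condition
  -- and passes to the closure.
  obtain ⟨M, hM1, hM⟩ := exists_dualWeights hι (closure (E N)) isClosed_closure.measurableSet
    (hN.trans_le (measure_mono subset_closure))
  have hN1 : (1 : ℝ) ≤ max 1 (N : ℝ) := le_max_left _ _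
  refine ⟨M * max 1 (N : ℝ), one_le_mul_of_one_le_of_one_le hM1 hN1, fun p hp α => ?_⟩
  have hbd : ∀ m, ∀ t ∈ closure (E N),
      ‖homEval p m (Fin.cons 1 (fun i => ι i (t i)))‖ ≤ max 1 (N : ℝ) ^ (m + 1) := by
    intro m
    have hcont : Continuous fun t : Fin d → ℕ → Bool =>
        (Fin.cons 1 (fun i => ι i (t i)) : Fin (d + 1) → K) := by
      refine continuous_pi fun i => Fin.cases ?_ (fun i => ?_) i
      · simpa using continuous_const
      · simp only [Fin.cons_succ]
        exact (hι i).1.continuous.comp (continuous_apply i)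
    refine closure_minimal ?_
      (isClosed_le (((continuous_homEval p m).comp hcont).norm) continuous_const)
    rintro t ⟨x, hx, hx0, hxt, hc1, hc2⟩
    have hxe : (x 0)⁻¹ • x = Fin.cons 1 (fun i => ι i (t i)) := by
      rw [hxt]
      funext i
      refine Fin.cases ?_ (fun i => ?_) i
      · simp [hx0]
      · simp [div_eq_inv_mul]
    have h1 : ‖homEval p m x‖ ≤ (c x).toReal ^ (m + 1) := by
      have := ENNReal.toReal_mono (ENNReal.pow_ne_top (hc x hx)) (hp x hx m)
      simpa using this
    change ‖homEval p m (Fin.cons 1 (fun i => ι i (t i)))‖ ≤ max 1 (N : ℝ) ^ (m + 1)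
    rw [← hxe, homEval_smul, norm_mul, norm_pow, norm_inv]
    calc ‖x 0‖⁻¹ ^ m * ‖homEval p m x‖ ≤ ‖x 0‖⁻¹ ^ m * (c x).toReal ^ (m + 1) := by gcongr
      _ = ((c x).toReal / ‖x 0‖) ^ m * (c x).toReal := by
        rw [div_eq_mul_inv, mul_pow]; ring
      _ ≤ max 1 (N : ℝ) ^ m * max 1 (N : ℝ) := by
        gcongr
        · exact hc2.trans (le_max_right _ _)
        · exact hc1.trans (le_max_right _ _)
      _ = _ := (pow_succ _ _).symm
  obtain ⟨J, _, t, w, ht, hw, hwd⟩ := hM α.degree (fun i => α i.succ)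
    (fun i => Finsupp.le_degree _ _)
  rw [← sum_weights_mul_homEval (fun j i => ι i (t j i)) w hwd p]
  calc ‖∑ j, w j * homEval p α.degree (Fin.cons 1 fun i => ι i (t j i))‖
      ≤ ∑ j, ‖w j‖ * max 1 (N : ℝ) ^ (α.degree + 1) := by
        refine norm_sum_le_of_le _ fun j _ => ?_
        rw [norm_mul]
        exact mul_le_mul_of_nonneg_left (hbd _ _ (ht j)) (norm_nonneg _)
    _ ≤ M ^ (α.degree + 1) * max 1 (N : ℝ) ^ (α.degree + 1) := by
        rw [← Finset.sum_mul]
        gcongr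
    _ = _ := (mul_pow _ _ _).symm

/-- The coefficients of power series are linear combinations of values of the homogeneous
parts. -/
theorem exists_coeff_eq_sum_homEval {K : Type*} [NormedField K] {d : ℕ}
    {X : Set (Fin (d + 1) → K)} (hX : IsSpread X) (α : Fin (d + 1) →₀ ℕ) :
    ∃ (J : Type) (_ : Fintype J) (y : J → Fin (d + 1) → K) (w : J → K),
      ∀ p : MvPowerSeries (Fin (d + 1)) K,
        ∑ j, w j * homEval p α.degree (y j) = MvPowerSeries.coeff α p := by
  obtain ⟨ι, hι, -⟩ := hX
  -- No size estimate is wanted here, so the nodes may lie anywhere.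
  obtain ⟨M, -, hM⟩ := exists_dualWeights hι Set.univ MeasurableSet.univ (by simp)
  obtain ⟨J, _, t, w, -, -, hwd⟩ := hM α.degree (fun i => α i.succ)
    (fun i => Finsupp.le_degree _ _)
  exact ⟨J, inferInstance, fun j => Fin.cons 1 fun i => ι i (t j i), w,
    sum_weights_mul_homEval (fun j i => ι i (t j i)) w hwd⟩

/-! ### Sums of series with geometrically bounded coefficients. -/

/-- The sum factors into n geometric series. -/
theorem summable_pow_degree {r : ℝ} (h0 : 0 ≤ r) (h1 : r < 1) (n : ℕ) :
    Summable fun α : Fin n →₀ ℕ => r ^ α.degree := by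
  have key : ∀ n : ℕ, Summable fun β : Fin n → ℕ => ∏ i, r ^ β i := by
    intro n
    induction n with
    | zero => exact (hasSum_fintype _).summable
    | succ n ih =>
      rw [← (Fin.consEquiv fun _ => ℕ).summable_iff]
      have h := (summable_geometric_of_lt_one h0 h1).mul_of_nonneg ih
        (fun _ => by positivity) (fun _ => Finset.prod_nonneg fun _ _ => by positivity)
      refine h.congr fun p => ?_
      simp [Fin.consEquiv, Fin.prod_univ_succ]
  rw [← Finsupp.equivFunOnFinite.symm.summable_iff]
  refine (key n).congr fun β => ?_
  simp [Finsupp.degree_eq_sum, Finset.prod_pow_eq_pow_sum]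

section Normed

variable {K : Type*} [NormedField K] {n : ℕ}

theorem norm_prod_pow_le (y : Fin n → K) (α : Fin n →₀ ℕ) :
    ‖∏ i, y i ^ α i‖ ≤ ‖y‖ ^ α.degree := by
  rw [norm_prod, Finsupp.degree_eq_sum, ← Finset.prod_pow_eq_pow_sum]
  refine Finset.prod_le_prod (fun i _ => norm_nonneg _) fun i _ => ?_
  rw [norm_pow]
  exact pow_le_pow_left₀ (norm_nonneg _) (norm_le_pi_norm y i) _

theorem norm_term_le {p : MvPowerSeries (Fin n) K} {M : ℝ} (hM : 0 ≤ M)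
    (hp : ∀ α, ‖MvPowerSeries.coeff α p‖ ≤ M ^ (α.degree + 1)) (y : Fin n → K) (α : Fin n →₀ ℕ) :
    ‖MvPowerSeries.coeff α p * ∏ i, y i ^ α i‖ ≤ M * (M * ‖y‖) ^ α.degree := by
  rw [norm_mul, mul_pow, ← mul_assoc, ← pow_succ']
  exact mul_le_mul (hp α) (norm_prod_pow_le y α) (norm_nonneg _) (by positivity)

/-- The remainders of a power series with geometrically bounded coefficients. -/
theorem norm_sub_sum_homEval_le {p : MvPowerSeries (Fin n) K} {M : ℝ} (hM : 0 ≤ M)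
    (hp : ∀ α, ‖MvPowerSeries.coeff α p‖ ≤ M ^ (α.degree + 1)) {y : Fin n → K} {S : K}
    (hS : HasSum (fun α => MvPowerSeries.coeff α p * ∏ i, y i ^ α i) S) {θ : ℝ} (hθ0 : 0 ≤ θ)
    (hθ1 : θ ≤ 1) (hy : M * ‖y‖ ≤ 1 / 2 * θ) (N : ℕ) :
    ‖S - ∑ m ∈ Finset.range N, homEval p m y‖ ≤
      (∑' α : Fin n →₀ ℕ, M * (1 / 2 : ℝ) ^ α.degree) * θ ^ N := by
  classical
  have hsum := ((summable_pow_degree (r := 1 / 2) (by norm_num) (by norm_num) n).mul_left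
    M).hasSum.mul_right (θ ^ N)
  set s := (Finset.range N).biUnion (Finset.finsuppAntidiag (Finset.univ : Finset (Fin n)))
  have h1 : HasSum (fun α => if α ∈ s then MvPowerSeries.coeff α p * ∏ i, y i ^ α i else 0)
      (∑ m ∈ Finset.range N, homEval p m y) := by
    rw [← sum_biUnion_finsuppAntidiag]
    have := hasSum_sum_of_ne_finset_zero (L := SummationFilter.unconditional _) (s := s)
      (f := fun α => if α ∈ s then MvPowerSeries.coeff α p * ∏ i, y i ^ α i else 0)
      (fun b hb => if_neg hb)
    rwa [Finset.sum_congr rfl fun α hα => if_pos hα] at this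
  have h2 := hS.sub h1
  rw [← h2.tsum_eq]
  refine tsum_of_norm_bounded hsum fun α => ?_
  by_cases hα : α ∈ s
  · rw [if_pos hα, sub_self, norm_zero]
    positivity
  · rw [if_neg hα, sub_zero]
    have hN : N ≤ α.degree := by
      by_contra! h
      exact hα (mem_biUnion_finsuppAntidiag.2 h)
    refine (norm_term_le hM hp y α).trans ?_
    rw [mul_assoc]
    refine mul_le_mul_of_nonneg_left ?_ hM
    -- The powers of 1 / 2 give summability over all multi-indices, the powers of θ the decay in N.
    calc (M * ‖y‖) ^ α.degree ≤ (1 / 2 * θ) ^ α.degree := by gcongr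
      _ = (1 / 2) ^ α.degree * θ ^ α.degree := mul_pow _ _ _
      _ ≤ (1 / 2) ^ α.degree * θ ^ N :=
        mul_le_mul_of_nonneg_left (pow_le_pow_of_le_one hθ0 hθ1 hN) (by positivity)

end Normed

/-! ### Convergence of coefficients, Taylor series along lines, analyticity. -/

section Nontrivially

variable {K : Type*} [NontriviallyNormedField K]

/-- If power series with uniformly geometrically bounded coefficients tend to zero pointwise near
the origin, then their coefficients tend to zero. -/
theorem tendsto_coeff_zero {d : ℕ} {X : Set (Fin (d + 1) → K)} (hX : IsSpread X) {κ : Type*}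
    {l : Filter κ} {q : κ → MvPowerSeries (Fin (d + 1)) K} {M ρ : ℝ} (hM : 0 < M) (hρ : 0 < ρ)
    (hq : ∀ᶠ i in l, ∀ α, ‖MvPowerSeries.coeff α (q i)‖ ≤ M ^ (α.degree + 1))
    {S : κ → (Fin (d + 1) → K) → K}
    (hS : ∀ᶠ i in l, ∀ y, ‖y‖ < ρ →
      HasSum (fun α => MvPowerSeries.coeff α (q i) * ∏ j, y j ^ α j) (S i y))
    (hS0 : ∀ y, ‖y‖ < ρ → Tendsto (fun i => S i y) l (𝓝 0)) (α : Fin (d + 1) →₀ ℕ) :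
    Tendsto (fun i => MvPowerSeries.coeff α (q i)) l (𝓝 0) := by
  induction hm : α.degree using Nat.strong_induction_on generalizing α with
  | _ m ih =>
  have hlow : ∀ k < m, ∀ y, Tendsto (fun i => homEval (q i) k y) l (𝓝 0) := by
    intro k hk y
    unfold homEval
    rw [show (0 : K) = ∑ β ∈ Finset.finsuppAntidiag (Finset.univ : Finset (Fin (d + 1))) k,
      0 * ∏ i, y i ^ β i by simp]
    exact tendsto_finsetSum _ fun β hβ =>
      (ih k hk β (mem_finsuppAntidiag_univ.1 hβ)).mul_const _
  -- Up to an error O(‖z‖ ^ (m + 1)), uniform in i, `S i (z • x)` minus its parts of lower degree is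
  -- z ^ m times the wanted value. Fix one z for which the error is below ε / 2 * ‖z‖ ^ m; at this
  -- z, pointwise convergence suffices.
  have hhom : ∀ x, Tendsto (fun i => homEval (q i) m x) l (𝓝 0) := by
    intro x
    set T : ℝ := ∑' α : Fin (d + 1) →₀ ℕ, M * (1 / 2 : ℝ) ^ α.degree
    have hT : 0 ≤ T := tsum_nonneg fun α => by positivity
    -- With this choice ‖z‖ / r can serve as θ in the remainder estimate; 1 + ‖x‖ avoids dividing by
    -- zero.
    set r : ℝ := min (ρ / 2) (1 / (2 * M)) / (1 + ‖x‖)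
    have hr : 0 < r := by positivity
    have hr1 : r * (1 + ‖x‖) = min (ρ / 2) (1 / (2 * M)) := by
      simp only [r]
      field_simp
    rw [NormedAddGroup.tendsto_nhds_zero]
    intro ε hε
    obtain ⟨z, hz0, hz⟩ := NormedField.exists_norm_lt K
      (show 0 < min r (ε / 2 * r ^ (m + 1) / (T + 1)) by positivity)
    have hzr : ‖z‖ ≤ r := (hz.trans_le (min_le_left _ _)).le
    have hzx : ‖z • x‖ ≤ ‖z‖ / r * min (ρ / 2) (1 / (2 * M)) := by
      rw [norm_smul, ← hr1]
      calc ‖z‖ * ‖x‖ ≤ ‖z‖ * (1 + ‖x‖) := by gcongr; linarith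
        _ = _ := by field_simp
    have hθ1 : ‖z‖ / r ≤ 1 := (div_le_one hr).2 hzr
    have hθ0 : 0 ≤ ‖z‖ / r := by positivity
    have hzρ : ‖z • x‖ < ρ := by
      have : ‖z‖ / r * min (ρ / 2) (1 / (2 * M)) ≤ 1 * (ρ / 2) :=
        mul_le_mul hθ1 (min_le_left _ _) (by positivity) zero_le_one
      linarith
    have hMz : M * ‖z • x‖ ≤ 1 / 2 * (‖z‖ / r) := by
      calc M * ‖z • x‖ ≤ M * (‖z‖ / r * (1 / (2 * M))) := by
            refine mul_le_mul_of_nonneg_left (hzx.trans ?_) hM.le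
            exact mul_le_mul_of_nonneg_left (min_le_right _ _) hθ0
        _ = _ := by field_simp
    have hsmall : Tendsto (fun i => (‖S i (z • x)‖ +
        ∑ k ∈ Finset.range m, ‖homEval (q i) k (z • x)‖) / ‖z‖ ^ m) l (𝓝 0) := by
      have h1 := (hS0 _ hzρ).norm.add (tendsto_finsetSum (Finset.range m) fun k hk =>
        (hlow k (Finset.mem_range.1 hk) (z • x)).norm)
      simpa using h1.div_const (‖z‖ ^ m)
    filter_upwards [hq, hS, hsmall.eventually (gt_mem_nhds (half_pos hε))] with i hqi hSi hi
    have htail := norm_sub_sum_homEval_le hM.le hqi (hSi _ hzρ) hθ0 hθ1 hMz (m + 1)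
    rw [Finset.sum_range_succ, homEval_smul _ m] at htail
    have hzm : 0 < ‖z‖ ^ m := pow_pos hz0 m
    have h2 : ‖z‖ ^ m * ‖homEval (q i) m x‖ ≤ (‖S i (z • x)‖ +
        ∑ k ∈ Finset.range m, ‖homEval (q i) k (z • x)‖) + T * (‖z‖ / r) ^ (m + 1) := by
      rw [← norm_pow, ← norm_mul]
      calc ‖z ^ m * homEval (q i) m x‖ = ‖(S i (z • x) -
            ∑ k ∈ Finset.range m, homEval (q i) k (z • x)) - (S i (z • x) -
            (∑ k ∈ Finset.range m, homEval (q i) k (z • x) + z ^ m * homEval (q i) m x))‖ := by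
              congr 1; ring
        _ ≤ (‖S i (z • x)‖ + ‖∑ k ∈ Finset.range m, homEval (q i) k (z • x)‖) +
            T * (‖z‖ / r) ^ (m + 1) :=
              (norm_sub_le _ _).trans (add_le_add (norm_sub_le _ _) htail)
        _ ≤ _ := by gcongr; exact norm_sum_le _ _
    have h3 : ‖homEval (q i) m x‖ ≤ (‖S i (z • x)‖ +
        ∑ k ∈ Finset.range m, ‖homEval (q i) k (z • x)‖) / ‖z‖ ^ m + T * ‖z‖ / r ^ (m + 1) := by
      rw [← mul_le_mul_iff_right₀ hzm]
      refine h2.trans (le_of_eq ?_)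
      rw [div_pow, pow_succ ‖z‖]
      field_simp
    have h4 : T * ‖z‖ / r ^ (m + 1) < ε / 2 := by
      have h5 := (lt_div_iff₀ (show 0 < T + 1 by positivity)).1 (hz.trans_le (min_le_right _ _))
      rw [div_lt_iff₀ (by positivity)]
      nlinarith
    linarith
  obtain ⟨J, _, y, w, hw⟩ := exists_coeff_eq_sum_homEval hX α
  simp_rw [← hw]
  rw [show (0 : K) = ∑ j, w j * 0 by simp]
  exact tendsto_finsetSum _ fun j _ => (hm ▸ hhom (y j)).const_mul _

/-- The Taylor series of a function gives its expansions along lines. -/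
theorem coeff_eq_homEval {n : ℕ} {f : (Fin n → K) → K} {u : Fin n → K}
    {p : MvPowerSeries (Fin n) K} (hp : IsTaylorSeriesAt f u p) {x : Fin n → K}
    {P : FormalMultilinearSeries K K K} (hP : HasFPowerSeriesAt (fun z : K => f (u + z • x)) P 0)
    (m : ℕ) : P.coeff m = homEval p m x := by
  -- Both expansions approximate the same function of z, so their difference is o(‖z‖ ^ N); a first
  -- nonzero coefficient of it would contradict this.
  have key : ∀ N : ℕ, (fun z : K => ∑ k ∈ Finset.range (N + 1),
      (P.coeff k - homEval p k x) * z ^ k) =o[𝓝 0] fun z => ‖z‖ ^ N := by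
    intro N
    have hlim : Tendsto (fun z : K => z • x) (𝓝 0) (𝓝 0) := by
      have : Continuous fun z : K => z • x := by fun_prop
      simpa using this.tendsto 0
    have h1 := (hp N).comp_tendsto hlim
    have h2 : (fun z : K => ‖z • x‖ ^ N) =O[𝓝 0] fun z => ‖z‖ ^ N := by
      refine Asymptotics.IsBigO.of_bound (‖x‖ ^ N) (Eventually.of_forall fun z => ?_)
      rw [norm_smul, mul_pow, mul_comm]
      simp
    have h3 := h1.trans_isBigO h2
    have h4 : (fun z : K => ‖z‖ ^ (N + 1)) =o[𝓝 0] fun z => ‖z‖ ^ N := by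
      have := (Asymptotics.isLittleO_pow_pow (𝕜 := ℝ) (Nat.lt_succ_self N)).comp_tendsto
        (tendsto_norm_zero (E := K))
      exact this
    have h5 := (hP.isBigO_sub_partialSum_pow (N + 1)).trans_isLittleO h4
    refine (h3.sub h5).congr_left fun z => ?_
    simp only [Function.comp, eval_truncTotal, homEval_smul, zero_add,
      FormalMultilinearSeries.partialSum, FormalMultilinearSeries.apply_eq_pow_smul_coeff,
      smul_eq_mul]
    rw [sub_sub_sub_cancel_left, ← Finset.sum_sub_distrib]
    exact Finset.sum_congr rfl fun k _ => by ring
  induction m using Nat.strong_induction_on with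
  | _ m ih =>
  by_contra hne
  have h := key m
  have h0 : 0 < ‖P.coeff m - homEval p m x‖ := norm_pos_iff.2 (sub_ne_zero.2 hne)
  have h1 := (h.def (half_pos h0)).filter_mono (nhdsWithin_le_nhds (s := {0}ᶜ))
  obtain ⟨z, hz, hz0⟩ := (h1.and self_mem_nhdsWithin).exists
  rw [Finset.sum_range_succ, Finset.sum_eq_zero fun k hk => by
    rw [ih k (Finset.mem_range.1 hk), sub_self, zero_mul], zero_add, norm_mul, norm_pow,
    Real.norm_of_nonneg (by positivity)] at hz
  have : 0 < ‖z‖ ^ m := pow_pos (norm_pos_iff.2 hz0) m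
  nlinarith

/-- The word `s` lists the multiset in which i occurs `α i` times. -/
theorem exists_prod_eq_prod_pow {n m : ℕ} (α : Fin n →₀ ℕ) (hα : α.degree = m) :
    ∃ s : Fin m → Fin n, ∀ y : Fin n → K, ∏ k, y (s k) = ∏ i, y i ^ α i := by
  classical
  have hlen : (Finsupp.toMultiset α).toList.length = m := by
    rw [Multiset.length_toList, Finsupp.card_toMultiset, ← hα]
    rfl
  subst hlen
  refine ⟨fun k => (Finsupp.toMultiset α).toList.get k, fun y => ?_⟩
  have h1 : ∏ k, y ((Finsupp.toMultiset α).toList.get k) =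
      ((Finsupp.toMultiset α).map y).prod := by
    conv_rhs => rw [← Multiset.coe_toList (Finsupp.toMultiset α), Multiset.map_coe,
      Multiset.prod_coe, ← List.ofFn_get (Finsupp.toMultiset α).toList, List.map_ofFn,
      List.prod_ofFn]
    rfl
  rw [h1, Finset.prod_multiset_map_count]
  simp only [Finsupp.count_toMultiset]
  refine Finset.prod_subset (Finset.subset_univ _) fun i _ hi => ?_
  have : α i = 0 := by simpa using hi
  rw [this, pow_zero]

/-- The map is not symmetrised, which could require dividing by zero in positive characteristic;
only its diagonal matters. -/
theorem exists_multilinear_monomial {n m : ℕ} (α : Fin n →₀ ℕ) (hα : α.degree = m) :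
    ∃ L : ContinuousMultilinearMap K (fun _ : Fin m => Fin n → K) K,
      (∀ y, L (fun _ => y) = ∏ i, y i ^ α i) ∧ ‖L‖ ≤ 1 := by
  obtain ⟨s, hs⟩ := exists_prod_eq_prod_pow (K := K) α hα
  refine ⟨(ContinuousMultilinearMap.mkPiAlgebra K (Fin m) K).compContinuousLinearMap
    fun k => ContinuousLinearMap.proj (s k), fun y => ?_, ?_⟩
  · rw [← hs]
    simp
  · refine ContinuousMultilinearMap.opNorm_le_bound zero_le_one fun v => ?_
    rw [one_mul, ContinuousMultilinearMap.compContinuousLinearMap_apply,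
      ContinuousMultilinearMap.mkPiAlgebra_apply, norm_prod]
    exact Finset.prod_le_prod (fun _ _ => norm_nonneg _) fun k _ => norm_le_pi_norm (v k) (s k)

/-- The homogeneous part of degree `m` of a power series is the diagonal of a multilinear map. -/
theorem exists_multilinear_homEval {n : ℕ} (p : MvPowerSeries (Fin n) K) (m : ℕ) :
    ∃ L : ContinuousMultilinearMap K (fun _ : Fin m => Fin n → K) K,
      (∀ y, L (fun _ => y) = homEval p m y) ∧
      ‖L‖ ≤ ∑ α ∈ Finset.finsuppAntidiag Finset.univ m, ‖MvPowerSeries.coeff α p‖ := by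
  choose! Λ hΛ hΛn using fun (α : Fin n →₀ ℕ) (hα : α.degree = m) =>
    exists_multilinear_monomial (K := K) α hα
  refine ⟨∑ α ∈ Finset.finsuppAntidiag Finset.univ m, MvPowerSeries.coeff α p • Λ α,
    fun y => ?_, norm_sum_le_of_le _ fun α hα => ?_⟩
  · rw [sum_apply, homEval]
    refine Finset.sum_congr rfl fun α hα => ?_
    rw [smul_apply, hΛ α (mem_finsuppAntidiag_univ.1 hα), smul_eq_mul]
  · rw [norm_smul]
    exact mul_le_of_le_one_right (norm_nonneg _) (hΛn α (mem_finsuppAntidiag_univ.1 hα))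

/-- A function that is the sum of a multivariate power series with geometrically bounded
coefficients is analytic. -/
theorem analyticAt_of_hasSum [CompleteSpace K] {n : ℕ} {f : (Fin n → K) → K} {u : Fin n → K}
    {p : MvPowerSeries (Fin n) K} {M ρ : ℝ} (hM : 0 < M) (hρ : 0 < ρ)
    (hp : ∀ α, ‖MvPowerSeries.coeff α p‖ ≤ M ^ (α.degree + 1))
    (hf : ∀ y ∈ Metric.ball u ρ, HasSum (seriesTerm p u y) (f y)) : AnalyticAt K f u := by
  choose L hL hLn using exists_multilinear_homEval p
  set R : ℝ := min ρ (1 / (2 * M))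
  have hR : 0 < R := by positivity
  have hMR : M * R ≤ 1 / 2 := by
    calc M * R ≤ M * (1 / (2 * M)) := by gcongr; exact min_le_right _ _
      _ = 1 / 2 := by field_simp
  have hsum := (summable_pow_degree (r := 1 / 2) (by norm_num) (by norm_num) n).mul_left M
  have hnn : ∀ α : Fin n →₀ ℕ, 0 ≤ M * (1 / 2 : ℝ) ^ α.degree := fun α => by positivity
  refine ⟨L, ENNReal.ofReal R, ⟨?_, by simpa using hR, fun {y} hy => ?_⟩⟩
  · refine FormalMultilinearSeries.le_radius_of_bound (r := R.toNNReal) _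
      (∑' α : Fin n →₀ ℕ, M * (1 / 2 : ℝ) ^ α.degree) fun m => ?_
    rw [Real.coe_toNNReal _ hR.le]
    calc ‖L m‖ * R ^ m ≤ (∑ α ∈ Finset.finsuppAntidiag Finset.univ m,
          ‖MvPowerSeries.coeff α p‖) * R ^ m := by gcongr; exact hLn m
      _ ≤ ∑ α ∈ Finset.finsuppAntidiag (Finset.univ : Finset (Fin n)) m,
          M * (1 / 2 : ℝ) ^ α.degree := by
        rw [Finset.sum_mul]
        refine Finset.sum_le_sum fun α hα => ?_
        rw [← mem_finsuppAntidiag_univ.1 hα]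
        calc ‖MvPowerSeries.coeff α p‖ * R ^ α.degree ≤ M ^ (α.degree + 1) * R ^ α.degree := by
              gcongr; exact hp α
          _ = M * (M * R) ^ α.degree := by rw [mul_pow]; ring
          _ ≤ _ := by gcongr
      _ ≤ _ := hsum.sum_le_tsum _ fun α _ => hnn α
  · have hyR : ‖y‖ < R := by
      rwa [Metric.eball_ofReal, mem_ball_zero_iff] at hy
    have h1 := hf (u + y) (by simpa using hyR.trans_le (min_le_left _ _))
    -- Unconditional summation permits grouping the terms by degree.
    have h2 := h1.tsum_fiberwise fun α : Fin n →₀ ℕ => α.degree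
    refine h2.congr_fun fun m => ?_
    have hset : (fun α : Fin n →₀ ℕ => α.degree) ⁻¹' {m} =
        (Finset.finsuppAntidiag (Finset.univ : Finset (Fin n)) m : Set (Fin n →₀ ℕ)) := by
      ext α
      rw [Finset.mem_coe, mem_finsuppAntidiag_univ]
      rfl
    rw [hset, Finset.tsum_subtype' (Finset.finsuppAntidiag Finset.univ m), hL]
    simp [seriesTerm, homEval]

end Nontrivially

/-! ### Local expansions of sections and closed sets of sections. -/

theorem ext_apply {E K : Type*} [TopologicalSpace E] [Zero K] {U : Opens E} (f : U → K) {y : E}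
    (hy : y ∈ U) : ext f y = f ⟨y, hy⟩ :=
  Subtype.val_injective.extend_apply f 0 ⟨y, hy⟩

theorem ext_restr {E K : Type*} [TopologicalSpace E] [Zero K] {U V : Opens E} (h : V ≤ U)
    (f : U → K) {y : E} (hy : y ∈ V) : ext (restr h f) y = ext f y := by
  rw [ext_apply _ hy, ext_apply _ (h hy), restr]

section

variable {K : Type*} [NontriviallyNormedField K]

theorem summable_seriesTerm [CompleteSpace K] {n : ℕ} {p : MvPowerSeries (Fin n) K} {M : ℝ}
    (hM : 0 < M) (hp : ∀ α, ‖MvPowerSeries.coeff α p‖ ≤ M ^ (α.degree + 1)) {u y : Fin n → K}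
    (hy : M * ‖y - u‖ ≤ 1 / 2) : Summable (seriesTerm p u y) := by
  refine Summable.of_norm_bounded ((summable_pow_degree (r := 1 / 2) (by norm_num)
    (by norm_num) n).mul_left M) fun α => (norm_term_le hM.le hp (y - u) α).trans ?_
  gcongr

/-- A pointwise limit of sums of power series with uniformly geometrically bounded coefficients
is the sum of a power series with the same bounds. -/
theorem exists_series_of_tendsto [CompleteSpace K] {d : ℕ} {X : Set (Fin (d + 1) → K)}
    (hX : IsSpread X) {u : Fin (d + 1) → K} {M ρ : ℝ} (hM : 0 < M) (hρ : 0 < ρ)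
    (hMρ : M * ρ ≤ 1 / 2) {F : ℕ → (Fin (d + 1) → K) → K} {f : (Fin (d + 1) → K) → K}
    (hF : ∀ k, ∃ p : MvPowerSeries (Fin (d + 1)) K,
      (∀ α, ‖MvPowerSeries.coeff α p‖ ≤ M ^ (α.degree + 1)) ∧
      ∀ y ∈ Metric.ball u ρ, HasSum (seriesTerm p u y) (F k y))
    (hlim : ∀ y ∈ Metric.ball u ρ, Tendsto (fun k => F k y) atTop (𝓝 (f y))) :
    ∃ p : MvPowerSeries (Fin (d + 1)) K,
      (∀ α, ‖MvPowerSeries.coeff α p‖ ≤ M ^ (α.degree + 1)) ∧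
      ∀ y ∈ Metric.ball u ρ, HasSum (seriesTerm p u y) (f y) := by
  choose p hp hs using hF
  have hball : ∀ y ∈ Metric.ball u ρ, M * ‖y - u‖ ≤ 1 / 2 := fun y hy => by
    rw [mem_ball_iff_norm] at hy
    exact (mul_le_mul_of_nonneg_left hy.le hM.le).trans hMρ
  have hcoeff : ∀ α, CauchySeq fun k => MvPowerSeries.coeff α (p k) := by
    intro α
    rw [cauchySeq_iff_tendsto_dist_atTop_0]
    -- Applied to differences over pairs of indices; doubling `M` absorbs the factor 2 from the
    -- triangle inequality.
    have h := tendsto_coeff_zero hX (l := (atTop : Filter (ℕ × ℕ)))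
      (q := fun k => p k.1 - p k.2) (S := fun k y => F k.1 (u + y) - F k.2 (u + y))
      (M := 2 * M) (by positivity) hρ ?_ ?_ ?_ α
    · simpa [dist_eq_norm] using h.norm
    · refine Eventually.of_forall fun k β => ?_
      rw [map_sub]
      have h2 : (1 : ℝ) ≤ 2 ^ β.degree := one_le_pow₀ one_le_two
      have h3 : 0 < M ^ (β.degree + 1) := by positivity
      calc _ ≤ M ^ (β.degree + 1) + M ^ (β.degree + 1) :=
            (norm_sub_le _ _).trans (add_le_add (hp _ _) (hp _ _))
        _ = 2 * 1 * M ^ (β.degree + 1) := by ring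
        _ ≤ 2 * 2 ^ β.degree * M ^ (β.degree + 1) := by gcongr
        _ = _ := by rw [mul_pow, pow_succ' (2 : ℝ)]
    · refine Eventually.of_forall fun k y hy => ?_
      have hy' : u + y ∈ Metric.ball u ρ := by simpa using hy
      refine ((hs k.1 _ hy').sub (hs k.2 _ hy')).congr_fun fun β => ?_
      simp [seriesTerm, sub_mul]
    · intro y hy
      have hy' : u + y ∈ Metric.ball u ρ := by simpa using hy
      rw [← prod_atTop_atTop_eq, ← sub_self (f (u + y))]
      exact ((hlim _ hy').comp tendsto_fst).sub ((hlim _ hy').comp tendsto_snd)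
  choose b hb using fun α => cauchySeq_tendsto_of_complete (hcoeff α)
  set q : MvPowerSeries (Fin (d + 1)) K := b
  have hqb : ∀ α, MvPowerSeries.coeff α q = b α := fun α => rfl
  have hq : ∀ α, ‖MvPowerSeries.coeff α q‖ ≤ M ^ (α.degree + 1) := fun α =>
    le_of_tendsto (hb α).norm (Eventually.of_forall fun k => hp k α)
  refine ⟨q, hq, fun y hy => ?_⟩
  -- The common geometric bound lets the limit pass through the sum.
  have h1 := tendsto_tsum_of_dominated_convergence (𝓕 := atTop) (f := fun k => seriesTerm (p k) u y)
    (g := seriesTerm q u y)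
    ((summable_pow_degree (r := 1 / 2) (by norm_num) (by norm_num) (d + 1)).mul_left M)
    (fun α => (hb α).mul_const _)
    (Eventually.of_forall fun k α => (norm_term_le hM.le (hp k) (y - u) α).trans (by
      have := hball y hy
      gcongr))
  simp_rw [fun k => (hs k y hy).tsum_eq] at h1
  rw [tendsto_nhds_unique (hlim y hy) h1]
  exact (summable_seriesTerm hM hq (hball y hy)).hasSum

/-- Sections of a gentric subpresheaf are sums of power series, with bounds that depend only on
the slice estimates. -/
theorem exists_series_of_gentric [CompleteSpace K] {d : ℕ}
    {𝓕 𝓖 : FunctionPresheaf (Fin (d + 1) → K) K} {X : Set (Fin (d + 1) → K)}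
    (hslice : IsSliceAnalytic 𝓕 X) {r : (U : Opens (Fin (d + 1) → K)) → (U → K) → ℝ≥0∞}
    {c : (Fin (d + 1) → K) → (Fin (d + 1) → K) → ℝ≥0∞ → Opens (Fin (d + 1) → K) → ℝ≥0∞}
    (hc : HasSliceEstimates 𝓕 X r c) (h𝓖 : IsPreGentric 𝓖) {V : Opens (Fin (d + 1) → K)}
    {g : V → K} (hg𝓕 : g ∈ 𝓕.sections V) (hg𝓖 : g ∈ 𝓖.sections V) {u : Fin (d + 1) → K}
    (hu : u ∈ V) {t : ℝ≥0∞} (ht : r V g ≤ t) {M ρ : ℝ} (hM : 0 < M) (hρ : 0 < ρ)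
    (hMρ : M * ρ ≤ 1 / 2) (hV : Metric.ball u ρ ⊆ V)
    (hbound : ∀ p : MvPowerSeries (Fin (d + 1)) K,
      (∀ x ∈ X, ∀ m, ‖homEval p m x‖ₑ ≤ c x u t V ^ (m + 1)) →
      ∀ α, ‖MvPowerSeries.coeff α p‖ ≤ M ^ (α.degree + 1)) :
    ∃ p : MvPowerSeries (Fin (d + 1)) K,
      (∀ α, ‖MvPowerSeries.coeff α p‖ ≤ M ^ (α.degree + 1)) ∧
      ∀ y ∈ Metric.ball u ρ, HasSum (seriesTerm p u y) (ext g y) := by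
  obtain ⟨p, -, hp⟩ := h𝓖.1 V g hg𝓖
  have htaylor : IsTaylorSeriesAt (ext g) u (p u) := fun N =>
    (hp u hu N).comp_tendsto ((Continuous.prodMk_right u).tendsto' 0 (u, 0) rfl)
  have hpM : ∀ α, ‖MvPowerSeries.coeff α (p u)‖ ≤ M ^ (α.degree + 1) := by
    refine hbound _ fun x hx m => ?_
    obtain ⟨P, hP⟩ := hslice V g hg𝓕 u hu x hx
    rw [← coeff_eq_homEval htaylor hP]
    have hexp : IsSliceExpansion (ext g) u x P.coeff := by
      filter_upwards [hP.eventually_hasSum] with z hz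
      simpa [mul_comm] using hz
    exact (hc.bound V g hg𝓕 x hx u hu _ hexp m).trans
      (pow_le_pow_left₀ zero_le (hc.mono V x hx u hu ht) _)
  refine ⟨p u, hpM, ?_⟩
  -- The gentric condition concerns sections over a ball centred at u, so g is restricted to one
  -- where the coefficient bounds force convergence.
  set W : Opens (Fin (d + 1) → K) := ⟨Metric.ball u ρ, Metric.isOpen_ball⟩
  have hWV : W ≤ V := hV
  have hW : ∀ᶠ h in 𝓝 (0 : Fin (d + 1) → K), u + h ∈ W := by
    have : Tendsto (fun h : Fin (d + 1) → K => u + h) (𝓝 0) (𝓝 u) :=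
      (continuous_const_add u).tendsto' _ _ (add_zero u)
    exact this.eventually (Metric.ball_mem_nhds u hρ)
  have htaylor' : IsTaylorSeriesAt (ext (restr hWV g)) u (p u) := fun N => by
    refine (htaylor N).congr' ?_ EventuallyEq.rfl
    filter_upwards [hW] with h hh
    rw [ext_restr hWV g hh]
  intro y hy
  rw [← ext_restr hWV g hy]
  refine h𝓖.2 u ρ W hρ rfl _ (𝓖.restr_mem hWV hg𝓖) (p u) htaylor' (fun y hy => ?_) y hy
  refine summable_seriesTerm hM hpM ((mul_le_mul_of_nonneg_left ?_ hM.le).trans hMρ)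
  exact (mem_ball_iff_norm.1 hy).le

/-- A set of sections that is closed under sequential limits is closed. -/
theorem isClosed_controlTopology {n : ℕ} {𝓕 : FunctionPresheaf (Fin n → K) K}
    {r : (U : Opens (Fin n → K)) → (U → K) → ℝ≥0∞} {V : Opens (Fin n → K)}
    {A : Set (𝓕.sections V)}
    (hA : ∀ (F : ℕ → 𝓕.sections V) (f : 𝓕.sections V), (∀ k, F k ∈ A) →
      Tendsto (fun k => r V ((F k : V → K) - (f : V → K))) atTop (𝓝 0) → f ∈ A) :
    @IsClosed _ (controlTopology 𝓕 r V) A := by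
  refine (@isOpen_compl_iff _ A (controlTopology 𝓕 r V)).1 fun f hf => ?_
  -- If no ε worked at f, the choices ε = 1 / (k + 1) would give a sequence in `A` converging to f.
  by_contra! h
  choose F hF hFA using fun k : ℕ => h ((k : ℝ≥0∞) + 1)⁻¹ (by simp)
  refine hf (hA F f (fun k => not_not.1 (hFA k)) ?_)
  refine tendsto_of_tendsto_of_tendsto_of_le_of_le tendsto_const_nhds
    (ENNReal.tendsto_inv_nat_nhds_zero.comp (tendsto_add_atTop_nat 1)) (fun _ => zero_le)
    fun k => ?_
  simpa using (hF k).le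

end

end Noble

/-! ### Analyticity of sections of noble presheaves. -/

theorem mainTheorem6 {K : Type*} [NontriviallyNormedField K] [CompleteSpace K] {d : ℕ}
    (𝓕 : Noble.FunctionPresheaf (Fin (d + 1) → K) K) (h𝓕 : Noble.IsNoble 𝓕)
    (U : TopologicalSpace.Opens (Fin (d + 1) → K)) (f : U → K) (hf : f ∈ 𝓕.sections U) :
    AnalyticOnNhd K (Noble.ext f) (U : Set (Fin (d + 1) → K)) := by
  obtain ⟨-, X, hX, hslice, r, hr, ⟨c, hc⟩, 𝓖, ⟨h𝓖, -⟩, hsub, hdense⟩ := h𝓕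
  intro u hu
  obtain ⟨R, hR, hRU⟩ := Metric.nhds_basis_closedBall.mem_iff.1 (U.2.mem_nhds hu)
  set V : Opens (Fin (d + 1) → K) := ⟨Metric.ball u R, Metric.isOpen_ball⟩
  have huV : u ∈ V := Metric.mem_ball_self hR
  have hVU : V ≤ U := Metric.ball_subset_closedBall.trans hRU
  have hVb : Bornology.IsBounded (V : Set (Fin (d + 1) → K)) := Metric.isBounded_ball
  have hVc : closure (V : Set (Fin (d + 1) → K)) ⊆ U :=
    Metric.closure_ball_subset_closedBall.trans hRU
  have hfin : r V (Noble.restr hVU f) ≠ ∞ := hr.finite V U hVU hVb hVc f hf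
  -- The added 1 makes r f < t strict, an inequality inherited by sections eventually in any
  -- sequence converging to f, while t stays finite.
  set t : ℝ≥0∞ := r V (Noble.restr hVU f) + 1
  have ht : t ≠ ∞ := by simp [t, hfin]
  obtain ⟨M, hM1, hM⟩ := Noble.exists_coeff_bound hX (fun x => c x u t V)
    fun x hx => hc.finite V x hx u huV t ht
  have hM0 : 0 < M := zero_lt_one.trans_le hM1
  set ρ : ℝ := min R (1 / (2 * M))
  have hρ : 0 < ρ := by positivity
  have hMρ : M * ρ ≤ 1 / 2 := by
    calc M * ρ ≤ M * (1 / (2 * M)) := by gcongr; exact min_le_right _ _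
      _ = 1 / 2 := by field_simp
  have hρV : Metric.ball u ρ ⊆ V := Metric.ball_subset_ball (min_le_left _ _)
  -- The premise r h < t is what makes `A` closed: if a limit satisfies it, then so do almost all
  -- members of the sequence, by continuity of r, and these have expansions with the common bound
  -- `M`. Sections with r h ≥ t belong to `A` vacuously, so `A` contains all of 𝓖.
  set A : Set (𝓕.sections V) := {h | r V h < t → ∃ p : MvPowerSeries (Fin (d + 1)) K,
    (∀ α, ‖MvPowerSeries.coeff α p‖ ≤ M ^ (α.degree + 1)) ∧
    ∀ y ∈ Metric.ball u ρ, HasSum (Noble.seriesTerm p u y) (Noble.ext (h : V → K) y)}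
  have hGA : {g : 𝓕.sections V | (g : V → K) ∈ 𝓖.sections V} ⊆ A := fun g hg hgt =>
    Noble.exists_series_of_gentric hslice hc h𝓖 g.2 hg huV hgt.le hM0 hρ hMρ hρV hM
  have hA : @IsClosed _ (Noble.controlTopology 𝓕 r V) A := by
    refine Noble.isClosed_controlTopology fun F h hFA hlim hht => ?_
    obtain ⟨N, hN⟩ := eventually_atTop.1 ((hr.continuous V (fun k => F k) h (fun k => (F k).2) h.2
      hlim).eventually (gt_mem_nhds hht))
    have hunif := hr.uniform V (fun k => F k) h (fun k => (F k).2) h.2 hlim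
    refine Noble.exists_series_of_tendsto hX hM0 hρ hMρ
      (F := fun k => Noble.ext (F (k + N) : V → K))
      (fun k => hFA (k + N) (hN _ (Nat.le_add_left _ _))) fun y hy => ?_
    simp only [Noble.ext_apply _ (hρV hy)]
    exact (hunif.tendsto_at ⟨y, hρV hy⟩).comp (tendsto_add_atTop_nat N)
  have hfA := (@closure_minimal _ (Noble.controlTopology 𝓕 r V) _ _ hGA hA)
    (hdense U V hVU hVb hVc f hf)
  obtain ⟨p, hp, hs⟩ := hfA (ENNReal.lt_add_right hfin one_ne_zero)
  refine Noble.analyticAt_of_hasSum hM0 hρ hp fun y hy => ?_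
  rw [← Noble.ext_restr hVU f (hρV hy)]
  exact hs y hy
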